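/- Let $n\ge 4$ and let $B_n\subseteq\mathbb{R}^{n\times n}$ be the $n$-th Birkhoff polytope, i.e. the set of doubly stochastic real $n\times n$ matrices, with rows and columns indexed by $\{0,\dots,n-1\}$. An extended formulation of size $r$ of a polytope $P\subseteq\mathbb{R}^d$ is a system of $r$ linear inequalities and any number of linear equations, defining a polyhedron $Q\subseteq\mathbb{R}^e$ for some $e$, together with an affine map $\pi:\mathbb{R}^e\to\mathbb{R}^d$ such that $\pi(Q)=P$. The extension complexity $\operatorname{xc}(P)$ is the smallest size of an extended formulation of $P$. Then $$\operatorname{xc}(B_n)=n^2 .$$ Moreover, the facet versus vertex non-incidence matrix of $B_n$ (rows indexed by the facets $F$, columns by the vertices $v$, with entry $0$ if $v\in F$ and $1$ if $v\notin F$) has the following explicit fooling set of size $n^2$, where a fooling set of a matrix $M$ is a set of positions $(a,b)$ with $M_{a,b}\neq 0$ such that $M_{a,b'}=0$ or $M_{a',b}=0$ for any two distinct positions $(a,b),(a',b')$ in it. It consists of the pairs $(F_{i,j},v_{i,j})$ for $i,j\in\{0,\dots,n-1\}$, where $F_{i,j}=\{x\in B_n : x_{i,j}=0\}$ (which is a facet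 of $B_n$) and $v_{i,j}$ is the permutation matrix, with ones at the positions $(k,\pi(k))$, of the permutation $\pi=\pi_{i,j}$ of $\{0,\dots,n-1\}$ given, modulo $n$, by $\pi(i)=j$, $\pi(i+1)=j+1$, and $\pi(k)=i+j+1-k$ for $k\notin\{i,i+1\}$. -/

import Mathlib

open scoped Matrix

/-- `P` has an extended formulation of size `r`: a system of `r` linear inequalities `A y ≤ b` and
any number of linear equations `C y = d` in some space `ℝ^e`, whose solution set (a polyhedron,
bounded or not) is mapped onto `P` by an affine map. Only the inequalities count. -/
def HasExtendedFormulation {E : Type*} [AddCommGroup E] [Module ℝ E] (P : Set E) (r : ℕ) : Prop :=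
  ∃ (e k : ℕ) (A : Matrix (Fin r) (Fin e) ℝ) (b : Fin r → ℝ)
    (C : Matrix (Fin k) (Fin e) ℝ) (d : Fin k → ℝ) (φ : (Fin e → ℝ) →ᵃ[ℝ] E),
    φ '' {y | A *ᵥ y ≤ b ∧ C *ᵥ y = d} = P

/-- The extension complexity of a polytope: the smallest size of an extended formulation.
(Every polytope has one, so that this is a minimum. A positive value also certifies that the set
of sizes is not empty.) -/
noncomputable def extensionComplexity {E : Type*} [AddCommGroup E] [Module ℝ E]
    (P : Set E) : ℕ :=
  sInf {r | HasExtendedFormulation P r}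

/-- The `n`-th Birkhoff polytope: the doubly stochastic real `n × n` matrices. -/
def birkhoffPolytope (n : ℕ) : Set (Matrix (Fin n) (Fin n) ℝ) :=
  (doublyStochastic ℝ (Fin n) : Set (Matrix (Fin n) (Fin n) ℝ))

/-- A face of `P`: the points of `P` where some valid linear inequality `c x ≤ δ` is tight. -/
def IsFace {E : Type*} [AddCommGroup E] [Module ℝ E] (P F : Set E) : Prop :=
  ∃ (c : E →ₗ[ℝ] ℝ) (δ : ℝ), (∀ x ∈ P, c x ≤ δ) ∧ F = {x ∈ P | c x = δ}

open scoped Classical in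
/-- The dimension of the affine hull, with `-1` for the empty set. -/
noncomputable def affineDim {E : Type*} [AddCommGroup E] [Module ℝ E] (S : Set E) : ℤ :=
  if S.Nonempty then (Module.finrank ℝ (vectorSpan ℝ S) : ℤ) else -1

/-- A facet of `P`: a face whose dimension is one less than that of `P`. -/
def IsFacet {E : Type*} [AddCommGroup E] [Module ℝ E] (P F : Set E) : Prop :=
  IsFace P F ∧ affineDim F + 1 = affineDim P

open scoped Classical in
/-- The facet versus vertex non-incidence matrix of `P`. -/
noncomputable def nonIncidenceMatrix {E : Type*} [AddCommGroup E] [Module ℝ E] (P : Set E) :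
    Matrix {F : Set E // IsFacet P F} {v : E // v ∈ Set.extremePoints ℝ P} ℝ :=
  fun F v => if v.1 ∈ F.1 then 0 else 1

/-- A fooling set of a real matrix: a set of nonzero positions no two of which lie in a common
rectangle `I × J` of nonzero positions. -/
def IsFoolingSet {R C : Type*} (M : Matrix R C ℝ) (T : Set (R × C)) : Prop :=
  (∀ p ∈ T, M p.1 p.2 ≠ 0) ∧
    ∀ p ∈ T, ∀ q ∈ T, p ≠ q → M p.1 q.2 = 0 ∨ M q.1 p.2 = 0

/-- `π(i) = j`, `π(i+1) = j+1`, and `π(k) = i+j+1-k` for `k ∉ {i, i+1}`, all modulo `n`. -/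
def IsFoolingPerm {n : ℕ} (i j : Fin n) (π : Equiv.Perm (Fin n)) : Prop :=
  π i = j ∧
    (∀ k : Fin n, (k.val : ZMod n) = (i.val : ZMod n) + 1 →
      ((π k).val : ZMod n) = (j.val : ZMod n) + 1) ∧
    ∀ k : Fin n, k ≠ i → (k.val : ZMod n) ≠ (i.val : ZMod n) + 1 →
      ((π k).val : ZMod n) = (i.val : ZMod n) + (j.val : ZMod n) + 1 - (k.val : ZMod n)

/-! The upper bound is the defining system itself: one inequality per entry, with the row and column
sums as free equations. The lower bound (`HasExtendedFormulation.card_le`) avoids slack-matrix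
factorizations: in any extension, each coordinate `x i j` has an inequality that is tight over the
whole preimage of the face `x i j = 0` but slack at a chosen lift of its fooling vertex. A shared
inequality would be slack at both lifts, whereas the fooling condition puts one of the two vertices
on the other's face, so these inequalities are distinct. The fooling condition is arithmetic modulo
`n` (`IsFoolingPerm.apply_ne_or_apply_ne`): a violation would force `2 = 0` or `3 = 0` in `ZMod n`.
-/

open Filter Topology

/-! ### Lower bound on extended formulations from fooling patterns -/

/-- Finitely many strict inequalities survive a small enough perturbation. -/
theorem exists_pos_forall_add_mul_pos {κ : Type*} [Finite κ] (a c : κ → ℝ) :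
    ∃ ε : ℝ, 0 < ε ∧ ∀ k, 0 < a k → 0 < a k + ε * c k := by
  have h : ∀ᶠ ε in 𝓝[>] (0 : ℝ), ∀ k, 0 < a k → 0 < a k + ε * c k := by
    refine eventually_all.2 fun k => ?_
    by_cases hk : 0 < a k
    · have hc : Tendsto (fun ε : ℝ => a k + ε * c k) (𝓝 0) (𝓝 (a k + 0 * c k)) :=
        Continuous.tendsto (by fun_prop) 0
      rw [zero_mul, add_zero] at hc
      filter_upwards [(hc.eventually (lt_mem_nhds hk)).filter_mono nhdsWithin_le_nhds]
        with ε hε _ using hε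
    · exact Eventually.of_forall fun ε h => absurd h hk
  obtain ⟨ε, hε, hpos⟩ := (h.and self_mem_nhdsWithin).exists
  exact ⟨ε, hpos, hε⟩

/-- A nonempty convex set has a point at which every one of finitely many affine functions,
nonnegative on the set and not identically zero on it, is positive. -/
theorem Convex.exists_forall_pos {V κ : Type*} [AddCommGroup V] [Module ℝ V] [Finite κ]
    {S : Set V} (hS : Convex ℝ S) (hne : S.Nonempty) (s : κ → V →ᵃ[ℝ] ℝ)
    (hs : ∀ k, ∀ y ∈ S, 0 ≤ s k y) :
    ∃ y ∈ S, ∀ k, (∃ z ∈ S, 0 < s k z) → 0 < s k y := by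
  classical
  have := Fintype.ofFinite κ
  suffices h : ∀ t : Finset κ, ∃ y ∈ S, ∀ k ∈ t, (∃ z ∈ S, 0 < s k z) → 0 < s k y by
    simpa using h Finset.univ
  intro t
  induction t using Finset.induction_on with
  | empty => exact ⟨hne.some, hne.some_mem, by simp⟩
  | insert l t _ ih =>
    obtain ⟨y, hy, hpos⟩ := ih
    by_cases hl : ∃ z ∈ S, 0 < s l z
    · obtain ⟨z, hz, hzl⟩ := hl
      have hmid : ∀ k, s k (AffineMap.lineMap y z (1 / 2 : ℝ)) = (s k y + s k z) / 2 := by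
        intro k
        rw [AffineMap.apply_lineMap, AffineMap.lineMap_apply_ring']
        ring
      refine ⟨AffineMap.lineMap y z (1 / 2 : ℝ),
        hS.lineMap_mem hy hz ⟨by norm_num, by norm_num⟩, fun k hk hkS => ?_⟩
      rw [hmid]
      rcases Finset.mem_insert.1 hk with rfl | hk
      · linarith [hs k y hy]
      · linarith [hs k z hz, hpos k hk hkS]
    · refine ⟨y, hy, fun k hk hkS => ?_⟩
      rcases Finset.mem_insert.1 hk with rfl | hk
      · exact absurd hkS hl
      · exact hpos k hk hkS

/-- If affine functions nonnegative on `P`, each with a zero on `P`, and points of `P` form a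
fooling pattern, then their number bounds the size of every extended formulation of `P`. -/
theorem HasExtendedFormulation.card_le {E ι : Type*} [AddCommGroup E] [Module ℝ E] [Fintype ι]
    {P : Set E} {r : ℕ} (h : HasExtendedFormulation P r) (f : ι → E →ᵃ[ℝ] ℝ)
    (hf : ∀ i, ∀ x ∈ P, 0 ≤ f i x) (hzero : ∀ i, ∃ x ∈ P, f i x = 0)
    (v : ι → E) (hv : ∀ i, v i ∈ P) (hpos : ∀ i, 0 < f i (v i))
    (hfool : ∀ i j, i ≠ j → f i (v j) = 0 ∨ f j (v i) = 0) :
    Fintype.card ι ≤ r := by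
  obtain ⟨e, m, A, b, C, d, φ, rfl⟩ := h
  set Q : Set (Fin e → ℝ) := {y | A *ᵥ y ≤ b ∧ C *ᵥ y = d} with hQ
  let s : Fin r → (Fin e → ℝ) →ᵃ[ℝ] ℝ := fun k =>
    AffineMap.const ℝ _ (b k) - ((LinearMap.proj k).comp A.mulVecLin).toAffineMap
  have hs_apply : ∀ k y, s k y = b k - (A *ᵥ y) k := fun k y => rfl
  have hmem : ∀ y, y ∈ Q ↔ (∀ k, 0 ≤ s k y) ∧ C *ᵥ y = d := by
    intro y
    simp only [hQ, Set.mem_ofPred_eq, Pi.le_def, hs_apply, sub_nonneg]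
  have hline : ∀ (g : (Fin e → ℝ) →ᵃ[ℝ] ℝ) (y z : Fin e → ℝ) (t : ℝ),
      g (AffineMap.lineMap y z t) = g y + t * (g z - g y) := by
    intro g y z t
    rw [AffineMap.apply_lineMap, AffineMap.lineMap_apply_ring']
    ring
  have hlineC : ∀ (y z : Fin e → ℝ) (t : ℝ), C *ᵥ y = d → C *ᵥ z = d →
      C *ᵥ (AffineMap.lineMap y z t) = d := by
    intro y z t hy hz
    rw [AffineMap.lineMap_apply_module', Matrix.mulVec_add, Matrix.mulVec_smul, Matrix.mulVec_sub,
      hy, hz, sub_self, smul_zero, zero_add]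
  have hconvex : ∀ i, Convex ℝ {y ∈ Q | f i (φ y) = 0} := by
    intro i
    rw [convex_iff_segment_subset]
    rintro y ⟨hyQ, hy⟩ z ⟨hzQ, hz⟩ w hw
    rw [segment_eq_image_lineMap] at hw
    obtain ⟨t, ⟨ht0, ht1⟩, rfl⟩ := hw
    rw [hmem] at hyQ hzQ
    refine ⟨(hmem _).2 ⟨fun k => ?_, hlineC _ _ _ hyQ.2 hzQ.2⟩, ?_⟩
    · rw [hline]
      nlinarith [mul_nonneg (sub_nonneg.2 ht1) (hyQ.1 k), mul_nonneg ht0 (hzQ.1 k)]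
    · have := hline ((f i).comp φ) y z t
      rwa [AffineMap.comp_apply, AffineMap.comp_apply, AffineMap.comp_apply, hy, hz, sub_zero,
        mul_zero, add_zero] at this
  choose y hyQ hyv using hv
  -- Otherwise every inequality tight on the preimage of the face is also tight at `y i`. Then from
  -- a relatively interior point `z` of that preimage one can move slightly away from `y i` inside
  -- `Q`, which makes `f i` negative.
  have key : ∀ i, ∃ k, (∀ z ∈ Q, f i (φ z) = 0 → s k z = 0) ∧ 0 < s k (y i) := by
    intro i
    by_contra! hcon
    obtain ⟨_, ⟨z₀, hz₀Q, rfl⟩, hz₀⟩ := hzero i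
    obtain ⟨z, ⟨hzQ, hz⟩, hzpos⟩ := (hconvex i).exists_forall_pos ⟨z₀, hz₀Q, hz₀⟩ s
      fun k w hw => ((hmem w).1 hw.1).1 k
    obtain ⟨ε, hε, hεpos⟩ := exists_pos_forall_add_mul_pos (fun k => s k z)
      (fun k => s k z - s k (y i))
    have hwQ : AffineMap.lineMap z (y i) (-ε) ∈ Q := by
      refine (hmem _).2 ⟨fun k => ?_, hlineC _ _ _ ((hmem z).1 hzQ).2 ((hmem _).1 (hyQ i)).2⟩
      rw [hline]
      by_cases hk : ∃ w ∈ {y ∈ Q | f i (φ y) = 0}, 0 < s k w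
      · have := hεpos k (hzpos k hk)
        linarith
      · push Not at hk
        have htight : ∀ w ∈ Q, f i (φ w) = 0 → s k w = 0 := fun w hw hw0 =>
          le_antisymm (hk w ⟨hw, hw0⟩) (((hmem w).1 hw).1 k)
        have h1 := htight z hzQ hz
        have h2 := le_antisymm (hcon k htight) (((hmem _).1 (hyQ i)).1 k)
        rw [h1, h2]
        simp
    have h1 := hf i _ ⟨_, hwQ, rfl⟩
    have h2 := hline ((f i).comp φ) z (y i) (-ε)
    simp only [AffineMap.comp_apply, hz, hyv] at h2
    nlinarith [mul_pos hε (hpos i)]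
  choose κ hκ hκpos using key
  have hinj : Function.Injective κ := by
    intro i j hij
    by_contra hne
    rcases hfool i j hne with h0 | h0
    · have := hκ i (y j) (hyQ j) (by rw [hyv, h0])
      rw [hij] at this
      exact (hκpos j).ne' this
    · have := hκ j (y i) (hyQ i) (by rw [hyv, h0])
      rw [← hij] at this
      exact (hκpos i).ne' this
  simpa using Fintype.card_le_of_injective κ hinj

/-! ### The standard description of the Birkhoff polytope -/

theorem mem_birkhoffPolytope {n : ℕ} {x : Matrix (Fin n) (Fin n) ℝ} :
    x ∈ birkhoffPolytope n ↔
      (∀ i j, 0 ≤ x i j) ∧ (∀ i, ∑ j, x i j = 1) ∧ ∀ j, ∑ i, x i j = 1 :=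
  mem_doublyStochastic_iff_sum

/-- The defining inequalities and equations form an extended formulation of size `n ^ 2`. -/
theorem hasExtendedFormulation_birkhoffPolytope (n : ℕ) :
    HasExtendedFormulation (birkhoffPolytope n) (n ^ 2) := by
  let α : Fin (n * n) ≃ Fin n × Fin n := finProdFinEquiv.symm
  let β : Fin (n ^ 2) ≃ Fin (n * n) := finCongr (sq n)
  let φ : (Fin (n * n) → ℝ) →ₗ[ℝ] Matrix (Fin n) (Fin n) ℝ :=
    { toFun := fun y i j => y (α.symm (i, j))
      map_add' := fun _ _ => rfl
      map_smul' := fun _ _ => rfl }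
  -- The first `n` equations are the row sums, the last `n` the column sums.
  let C : Matrix (Fin (n + n)) (Fin (n * n)) ℝ := fun k l =>
    Sum.elim (fun i => if (α l).1 = i then 1 else 0) (fun j => if (α l).2 = j then 1 else 0)
      (finSumFinEquiv.symm k)
  have hφ : ∀ y i j, φ y i j = y (α.symm (i, j)) := fun _ _ _ => rfl
  have hα : ∀ g : Fin n × Fin n → ℝ, ∑ l, g (α l) = ∑ i, ∑ j, g (i, j) := by
    intro g
    rw [Equiv.sum_comp α g, Fintype.sum_prod_type]
  have hrow : ∀ y i, (C *ᵥ y) (finSumFinEquiv (Sum.inl i)) = ∑ j, φ y i j := by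
    intro y i
    have := hα fun p => (if p.1 = i then 1 else 0) * y (α.symm p)
    simp only [Equiv.symm_apply_apply] at this
    rw [Finset.sum_comm] at this
    simpa [Matrix.mulVec, dotProduct, C, hφ] using this
  have hcol : ∀ y j, (C *ᵥ y) (finSumFinEquiv (Sum.inr j)) = ∑ i, φ y i j := by
    intro y j
    have := hα fun p => (if p.2 = j then 1 else 0) * y (α.symm p)
    simp only [Equiv.symm_apply_apply] at this
    simpa [Matrix.mulVec, dotProduct, C, hφ, -finSumFinEquiv_apply_right] using this
  have hA : ∀ y k, ((-(1 : Matrix _ _ ℝ).submatrix β id) *ᵥ y) k = - y (β k) := by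
    intro y k
    simp [Matrix.mulVec, dotProduct, Matrix.one_apply]
  refine ⟨n * n, n + n, -(1 : Matrix _ _ ℝ).submatrix β id, 0, C, 1, φ.toAffineMap, ?_⟩
  ext x
  rw [mem_birkhoffPolytope]
  constructor
  · rintro ⟨y, ⟨hy, hC⟩, rfl⟩
    refine ⟨fun i j => ?_, fun i => ?_, fun j => ?_⟩
    · have := hy (β.symm (α.symm (i, j)))
      rw [hA] at this
      rw [LinearMap.coe_toAffineMap, hφ]
      simpa using this
    · exact (hrow y i).symm.trans (congrFun hC _)
    · exact (hcol y j).symm.trans (congrFun hC _)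
  · rintro ⟨h0, h1, h2⟩
    have hx : φ (fun l => x (α l).1 (α l).2) = x := by
      ext i j
      simp [hφ]
    refine ⟨fun l => x (α l).1 (α l).2, ⟨fun k => ?_, ?_⟩, hx⟩
    · rw [hA]
      simpa using h0 _ _
    · ext k
      obtain ⟨k | k, rfl⟩ := finSumFinEquiv.surjective k
      · rw [hrow, hx, h1]; rfl
      · rw [hcol, hx, h2]; rfl

/-! ### Facets -/

/-- For `n ≥ 3`, a doubly stochastic matrix whose only zero is at the position `(i, j)`. -/
theorem exists_mem_birkhoffPolytope_apply_eq_zero {n : ℕ} (hn : 3 ≤ n) (i j : Fin n) :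
    ∃ x ∈ birkhoffPolytope n, x i j = 0 ∧ ∀ k l, (k, l) ≠ (i, j) → 0 < x k l := by
  have hn' : (3 : ℝ) ≤ n := by exact_mod_cast hn
  have hn1 : (n : ℝ) - 1 ≠ 0 := by linarith
  let a : Fin n → ℝ := fun k => if k = i then 1 else 0
  let b : Fin n → ℝ := fun l => if l = j then 1 else 0
  -- The entries are `0` at `(i, j)`, `1 / (n - 1)` on the rest of row `i` and column `j`, and `(n -
  -- 2) / (n - 1) ^ 2` elsewhere.
  let x : Matrix (Fin n) (Fin n) ℝ := fun k l =>
    ((n - 2) + a k + b l - n * a k * b l) / (n - 1) ^ 2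
  have ha : ∑ k, a k = 1 := by simp [a]
  have hb : ∑ l, b l = 1 := by simp [b]
  have hpos : ∀ k l, (k, l) ≠ (i, j) → 0 < x k l := by
    intro k l hkl
    have h2 : (0 : ℝ) < (n - 1) ^ 2 := by positivity
    refine div_pos ?_ h2
    by_cases hk : k = i
    · have hl : l ≠ j := fun hl => hkl (by rw [hk, hl])
      simp only [a, b, if_pos hk, if_neg hl]
      linarith
    · simp only [a, b, if_neg hk]
      split_ifs <;> linarith
  have hij : x i j = 0 := by simp [x, a, b]; left; ring
  refine ⟨x, mem_birkhoffPolytope.2 ⟨fun k l => ?_, fun k => ?_, fun l => ?_⟩, hij, hpos⟩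
  · by_cases h : (k, l) = (i, j)
    · obtain ⟨rfl, rfl⟩ := Prod.mk.inj h
      exact hij.ge
    · exact (hpos k l h).le
  · simp only [x, ← Finset.sum_div, Finset.sum_sub_distrib, Finset.sum_add_distrib,
      ← Finset.mul_sum, hb]
    simp
    field_simp
    ring
  · simp only [x, ← Finset.sum_div, Finset.sum_sub_distrib, Finset.sum_add_distrib,
      ← Finset.mul_sum, ← Finset.sum_mul, ha]
    simp
    field_simp
    ring

/-- The vectors parallel to the Birkhoff polytope have zero row and column sums. -/
theorem sum_eq_zero_of_mem_vectorSpan_birkhoffPolytope {n : ℕ} {m : Matrix (Fin n) (Fin n) ℝ}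
    (hm : m ∈ vectorSpan ℝ (birkhoffPolytope n)) :
    (∀ i, ∑ j, m i j = 0) ∧ ∀ j, ∑ i, m i j = 0 := by
  rw [vectorSpan_def] at hm
  induction hm using Submodule.span_induction with
  | mem m hm =>
    obtain ⟨x, hx, y, hy, rfl⟩ := hm
    rw [mem_birkhoffPolytope] at hx hy
    simp [hx.2.1, hx.2.2, hy.2.1, hy.2.2]
  | zero => simp
  | add x y _ _ hx hy => simp [Finset.sum_add_distrib, hx.1, hx.2, hy.1, hy.2]
  | smul a x _ hx => simp [← Finset.mul_sum, hx.1, hx.2]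

/-- For `n ≥ 3`, the inequality `0 ≤ x i j` defines a facet of the Birkhoff polytope. -/
theorem isFacet_birkhoffPolytope {n : ℕ} (hn : 3 ≤ n) (i j : Fin n) :
    IsFacet (birkhoffPolytope n) {x ∈ birkhoffPolytope n | x i j = 0} := by
  obtain ⟨p, hpB, hpij, hppos⟩ := exists_mem_birkhoffPolytope_apply_eq_zero hn i j
  set F : Set (Matrix (Fin n) (Fin n) ℝ) := {x ∈ birkhoffPolytope n | x i j = 0}
  have hpF : p ∈ F := ⟨hpB, hpij⟩
  let c : Matrix (Fin n) (Fin n) ℝ →ₗ[ℝ] ℝ := Matrix.entryLinearMap ℝ ℝ i j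
  refine ⟨⟨-c, 0, fun x hx => ?_, ?_⟩, ?_⟩
  · simpa [c] using (mem_birkhoffPolytope.1 hx).1 i j
  · simp [F, c]
  have hspan : vectorSpan ℝ F = vectorSpan ℝ (birkhoffPolytope n) ⊓ LinearMap.ker c := by
    apply le_antisymm
    · refine le_inf (vectorSpan_mono ℝ (Set.sep_subset _ _)) ?_
      rw [vectorSpan_def, Submodule.span_le]
      rintro _ ⟨x, hx, y, hy, rfl⟩
      simp [c, hx.2, hy.2]
    -- Only the entry `(i, j)` of `p` vanishes, so `p + ε • m` stays in `F` for small `ε`.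
    · rintro m ⟨hm, hmc⟩
      have hmij : m i j = 0 := hmc
      obtain ⟨hr, hc⟩ := sum_eq_zero_of_mem_vectorSpan_birkhoffPolytope hm
      obtain ⟨ε, hε, hεpos⟩ := exists_pos_forall_add_mul_pos
        (fun q : Fin n × Fin n => p q.1 q.2) (fun q => m q.1 q.2)
      rw [mem_birkhoffPolytope] at hpB
      have hqF : p + ε • m ∈ F := by
        refine ⟨mem_birkhoffPolytope.2 ⟨fun k l => ?_, fun k => ?_, fun l => ?_⟩, ?_⟩
        · by_cases h : (k, l) = (i, j)
          · obtain ⟨rfl, rfl⟩ := Prod.mk.inj h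
            simp [hpij, hmij]
          · exact (hεpos (k, l) (hppos k l h)).le
        · simp [Finset.sum_add_distrib, ← Finset.mul_sum, hr, hpB.2.1]
        · simp [Finset.sum_add_distrib, ← Finset.mul_sum, hc, hpB.2.2]
        · simp [hpij, hmij]
      have := vsub_mem_vectorSpan ℝ hqF hpF
      rw [vsub_eq_sub, add_sub_cancel_left] at this
      exact (Submodule.smul_mem_iff _ hε.ne').1 this
  -- A vertex with entry `1` at `(i, j)`: the coordinate is nonzero on the direction space, so its
  -- kernel has codimension one.
  have hone : (Equiv.swap i j).permMatrix ℝ ∈ birkhoffPolytope n :=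
    permMatrix_mem_doublyStochastic
  have hne : c.domRestrict (vectorSpan ℝ (birkhoffPolytope n)) ≠ 0 := by
    intro h
    have := LinearMap.congr_fun h ⟨_, vsub_mem_vectorSpan ℝ hone hpB⟩
    simp [c, hpij, PEquiv.toMatrix_apply] at this
  have hrank := Module.Dual.finrank_ker_add_one_of_ne_zero hne
  rw [affineDim, affineDim, if_pos ⟨p, hpF⟩, if_pos ⟨p, hpB⟩, hspan, ← hrank,
    LinearMap.ker_domRestrict]
  push_cast
  rw [← Submodule.map_comap_subtype, Submodule.finrank_map_subtype_eq]

/-! ### Vertices and the fooling permutations -/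

theorem permMatrix_mem_extremePoints_birkhoffPolytope {n : ℕ} (π : Equiv.Perm (Fin n)) :
    π.permMatrix ℝ ∈ Set.extremePoints ℝ (birkhoffPolytope n) := by
  rw [birkhoffPolytope, extremePoints_doublyStochastic]
  exact ⟨π, rfl⟩

theorem Fin.natCast_val_zmod_injective (n : ℕ) :
    Function.Injective fun k : Fin n => (k.val : ZMod n) := by
  intro k l h
  have h' := (ZMod.natCast_eq_natCast_iff' _ _ _).1 h
  rw [Nat.mod_eq_of_lt k.2, Nat.mod_eq_of_lt l.2] at h'
  exact Fin.ext h'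

/-- The reflection `k ↦ i + j + 1 - k` sends `i` to `j + 1` and `i + 1` to `j`; swapping `i` and `i
+ 1` beforehand corrects these two values. -/
theorem exists_isFoolingPerm {n : ℕ} (i j : Fin n) :
    ∃ π : Equiv.Perm (Fin n), IsFoolingPerm i j π := by
  have : NeZero n := ⟨fun h => by subst h; exact i.elim0⟩
  let ε : Fin n ≃ ZMod n := Equiv.ofBijective (fun k => (k.val : ZMod n))
    ((Fintype.bijective_iff_injective_and_card _).2
      ⟨Fin.natCast_val_zmod_injective n, by simp [ZMod.card]⟩)
  have hε : ∀ k, ε k = (k.val : ZMod n) := fun k => rfl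
  let ρ : Equiv.Perm (ZMod n) := (Equiv.swap (ε i) (ε i + 1)).trans (Equiv.subLeft (ε i + ε j + 1))
  have hρ : ∀ k, ε ((ε.trans (ρ.trans ε.symm)) k) =
      ε i + ε j + 1 - Equiv.swap (ε i) (ε i + 1) (ε k) := by
    intro k
    simp [ρ]
  refine ⟨ε.trans (ρ.trans ε.symm), ε.injective ?_, fun k hk => ?_, fun k hk hk' => ?_⟩
  · rw [hρ, Equiv.swap_apply_left]
    ring
  · rw [← hε, ← hε] at hk
    rw [← hε, hρ, hk, Equiv.swap_apply_right, ← hε]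
    ring
  · rw [← hε, ← hε] at hk'
    rw [← hε, hρ, Equiv.swap_apply_of_ne_of_ne (ε.injective.ne hk) hk']
    rfl

/-- Two of the permutations cannot each contain the distinguished position of the other. -/
theorem IsFoolingPerm.apply_ne_or_apply_ne {n : ℕ} (hn : 4 ≤ n) {i j i' j' : Fin n}
    {π π' : Equiv.Perm (Fin n)} (hπ : IsFoolingPerm i j π) (hπ' : IsFoolingPerm i' j' π')
    (hne : (i, j) ≠ (i', j')) : π' i ≠ j ∨ π i' ≠ j' := by
  by_contra! hcon
  obtain ⟨h', h⟩ := hcon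
  have small : ∀ m : ℕ, 0 < m → m < 4 → (m : ZMod n) ≠ 0 := by
    intro m hm hm4 h0
    have := Nat.le_of_dvd hm ((ZMod.natCast_eq_zero_iff _ _).1 h0)
    omega
  have two : (2 : ZMod n) ≠ 0 := by exact_mod_cast small 2 (by norm_num) (by norm_num)
  have three : (3 : ZMod n) ≠ 0 := by exact_mod_cast small 3 (by norm_num) (by norm_num)
  have hi : i ≠ i' := by
    rintro rfl
    exact hne (by rw [← hπ.1, h])
  obtain ⟨-, hs, hr⟩ := hπ
  obtain ⟨-, hs', hr'⟩ := hπ'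
  have hs := hs i'
  have hr := hr i' hi.symm
  have hs' := hs' i
  have hr' := hr' i hi
  rw [h] at hs hr
  rw [h'] at hs' hr'
  generalize (i.val : ZMod n) = x at *
  generalize (i'.val : ZMod n) = x' at *
  generalize (j.val : ZMod n) = y at *
  generalize (j'.val : ZMod n) = y' at *
  -- If both or neither of `x' = x + 1` and `x = x' + 1` hold, the equations add up to `2 = 0`; if
  -- exactly one holds, to `3 = 0`.
  by_cases c : x' = x + 1
  · have e := hs c
    by_cases c' : x = x' + 1
    · exact two (by linear_combination -c - c')
    · exact three (by linear_combination -hr' c' - c - e)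
  · have e := hr c
    by_cases c' : x = x' + 1
    · have e' := hs' c'
      exact three (by linear_combination -e - e' - c')
    · exact two (by linear_combination -e - hr' c')

/-! ### The main theorem -/

theorem mainTheorem4 (n : ℕ) (hn : 4 ≤ n) :
    extensionComplexity (birkhoffPolytope n) = n ^ 2 ∧
    ∃ (F : Fin n × Fin n →
          {F : Set (Matrix (Fin n) (Fin n) ℝ) // IsFacet (birkhoffPolytope n) F})
      (v : Fin n × Fin n →
          {v : Matrix (Fin n) (Fin n) ℝ // v ∈ Set.extremePoints ℝ (birkhoffPolytope n)}),
      (∀ i j : Fin n, (F (i, j)).1 = {x ∈ birkhoffPolytope n | x i j = 0}) ∧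
      (∀ i j : Fin n, ∃ π : Equiv.Perm (Fin n),
          IsFoolingPerm i j π ∧ (v (i, j)).1 = π.permMatrix ℝ) ∧
      IsFoolingSet (nonIncidenceMatrix (birkhoffPolytope n)) (Set.range fun p => (F p, v p)) ∧
      (Set.range fun p => (F p, v p)).ncard = n ^ 2 := by
  have hfacet := fun p : Fin n × Fin n => isFacet_birkhoffPolytope (by omega : 3 ≤ n) p.1 p.2
  choose π hπ using fun p : Fin n × Fin n => exists_isFoolingPerm p.1 p.2
  have hext := fun p => permMatrix_mem_extremePoints_birkhoffPolytope (π p)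
  have happly : ∀ p q : Fin n × Fin n,
      (π p).permMatrix ℝ q.1 q.2 = if π p q.1 = q.2 then 1 else 0 := by
    intro p q
    simp [PEquiv.toMatrix_apply, eq_comm]
  have hself : ∀ p : Fin n × Fin n, (π p).permMatrix ℝ p.1 p.2 = 1 := by
    intro p
    rw [happly, if_pos (hπ p).1]
  have hcross : ∀ p q : Fin n × Fin n, p ≠ q →
      (π q).permMatrix ℝ p.1 p.2 = 0 ∨ (π p).permMatrix ℝ q.1 q.2 = 0 := by
    intro p q hpq
    rcases (hπ p).apply_ne_or_apply_ne hn (hπ q) hpq with h | h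
    · exact Or.inl (by rw [happly, if_neg h])
    · exact Or.inr (by rw [happly, if_neg h])
  -- Since `sInf ∅ = 0` in `ℕ`, the lower bound also needs some formulation to exist.
  refine ⟨le_antisymm (Nat.sInf_le (hasExtendedFormulation_birkhoffPolytope n))
    (le_csInf ⟨_, hasExtendedFormulation_birkhoffPolytope n⟩ fun r hr => ?_), ?_⟩
  · have := HasExtendedFormulation.card_le hr
      (fun p : Fin n × Fin n => (Matrix.entryLinearMap ℝ ℝ p.1 p.2).toAffineMap)
      (fun p x hx => (mem_birkhoffPolytope.1 hx).1 p.1 p.2)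
      (fun p => by
        obtain ⟨x, hx, h0, -⟩ :=
          exists_mem_birkhoffPolytope_apply_eq_zero (by omega : 3 ≤ n) p.1 p.2
        exact ⟨x, hx, h0⟩)
      (fun p => (π p).permMatrix ℝ) (fun p => (hext p).1)
      (fun p => one_pos.trans_eq (hself p).symm) hcross
    simpa [sq] using this
  let F : Fin n × Fin n → {F : Set (Matrix (Fin n) (Fin n) ℝ) // IsFacet (birkhoffPolytope n) F} :=
    fun p => ⟨_, hfacet p⟩
  let v : Fin n × Fin n →
      {v : Matrix (Fin n) (Fin n) ℝ // v ∈ Set.extremePoints ℝ (birkhoffPolytope n)} :=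
    fun p => ⟨_, hext p⟩
  have hM : ∀ p q, nonIncidenceMatrix (birkhoffPolytope n) (F p) (v q) = 0 ↔
      (π q).permMatrix ℝ p.1 p.2 = 0 := by
    intro p q
    have hmem : (v q).1 ∈ (F p).1 ↔ (π q).permMatrix ℝ p.1 p.2 = 0 :=
      ⟨fun h => h.2, fun h => ⟨(hext q).1, h⟩⟩
    rw [← hmem, nonIncidenceMatrix]
    split_ifs with h <;> simp [h]
  have hMself : ∀ p, nonIncidenceMatrix (birkhoffPolytope n) (F p) (v p) ≠ 0 := by
    intro p
    rw [Ne, hM, hself]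
    exact one_ne_zero
  have hMcross : ∀ p q, p ≠ q → nonIncidenceMatrix (birkhoffPolytope n) (F p) (v q) = 0 ∨
      nonIncidenceMatrix (birkhoffPolytope n) (F q) (v p) = 0 := by
    intro p q hpq
    rw [hM, hM]
    exact hcross p q hpq
  refine ⟨F, v, fun i j => rfl, fun i j => ⟨π (i, j), hπ (i, j), rfl⟩, ⟨?_, ?_⟩, ?_⟩
  · rintro _ ⟨p, rfl⟩
    exact hMself p
  · rintro _ ⟨p, rfl⟩ _ ⟨q, rfl⟩ hpq
    exact hMcross p q fun h => hpq (by rw [h])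
  -- If distinct indices gave the same pair, a zero cross entry would coincide with a nonzero
  -- diagonal one.
  · have hinj : Function.Injective fun p => (F p, v p) := by
      intro p q hpq
      obtain ⟨hF, hv⟩ := Prod.mk.inj hpq
      by_contra hne
      rcases hMcross p q hne with h | h
      · exact hMself p (hv ▸ h)
      · exact hMself p (hF ▸ h)
    rw [← Set.image_univ, Set.ncard_image_of_injective _ hinj, Set.ncard_univ]
    simp [sq]
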